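/- Let $d\ge 3$ be a fixed integer and let $k$ be a fixed integer with $k\ge 2$ if $d$ is even and $k\ge 1$ if $d$ is odd. Put $H=\lceil d/2\rceil+k$. A partition of the nodes $V$ of a simple graph is an ordered pair $P=\langle V_-,V_+\rangle$ of disjoint non-empty sets with $V_-\cup V_+=V$. It is $H$-assortative if every node has at least $H$ of its neighbours in its own group. The number of node flips between $P$ and $P'=\langle V'_-,V'_+\rangle$ is $|(V_+\cap V'_-)\cup(V_-\cap V'_+)|$. Then there is an $\epsilon>0$, depending only on $d$ and $k$, such that the following holds with high probability for a uniformly random simple $d$-regular graph $G$ on $n$ labelled nodes, that is, with probability tending to $1$ as $n\to\infty$ along those $n$ for which $dn$ is even: for every $H$-assortative partition $P$ of $G$ there is no $H$-assortative partition $P'\neq P$ of $G$ at most $\epsilon n$ node flips from $P$. (Such partitions $P$ are called frozen.) -/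

import Mathlib

open Filter Topology

/-- A partition of the nodes into two disjoint non-empty sets `⟨V₋, V₊⟩` (an ordered pair). -/
@[ext]
structure NodePartition (V : Type*) where
  neg : Set V
  pos : Set V
  neg_nonempty : neg.Nonempty
  pos_nonempty : pos.Nonempty
  disjoint : Disjoint neg pos
  union_eq : neg ∪ pos = Set.univ

namespace NodePartition

variable {V : Type*}

/-- `P` is an `H`-assortative partition of `G`: every node has at least `H` neighbours in its own
group. -/
def IsAssortative (G : SimpleGraph V) (H : ℕ) (P : NodePartition V) : Prop :=
  (∀ i ∈ P.neg, H ≤ (G.neighborSet i ∩ P.neg).ncard) ∧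
    (∀ i ∈ P.pos, H ≤ (G.neighborSet i ∩ P.pos).ncard)

/-- The set of nodes whose group differs between `P` and `P'`. -/
def flipped (P P' : NodePartition V) : Set V :=
  (P.pos ∩ P'.neg) ∪ (P.neg ∩ P'.pos)

/-- `P` is frozen at scale `ε`: no other `H`-assortative partition of `G` is at most `ε n` node
flips away from `P`, where `n` is the number of nodes. -/
def IsFrozen (G : SimpleGraph V) (H : ℕ) (ε : ℝ) (P : NodePartition V) : Prop :=
  ¬ ∃ P' : NodePartition V, P' ≠ P ∧ P'.IsAssortative G H ∧
    ((flipped P P').ncard : ℝ) ≤ ε * (Nat.card V : ℝ)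

end NodePartition

open scoped Classical in
/-- The set of simple `d`-regular graphs on the node set `Fin n`. -/
def regularGraphs (d n : ℕ) : Set (SimpleGraph (Fin n)) :=
  {G | G.IsRegularOfDegree d}

/-- The probability that a uniformly random simple `d`-regular graph on `n` labelled nodes
satisfies `Q`. -/
noncomputable def regularProb (d n : ℕ) (Q : SimpleGraph (Fin n) → Prop) : ℝ :=
  ({G | G ∈ regularGraphs d n ∧ Q G}.ncard : ℝ) / ((regularGraphs d n).ncard : ℝ)

/-- A graph property holds with high probability for random `d`-regular graphs: its probability
tends to `1` as the number `n` of nodes tends to infinity with `d * n` even. -/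
def WithHighProbability (d : ℕ) (Q : ∀ n : ℕ, SimpleGraph (Fin n) → Prop) : Prop :=
  Tendsto (fun n : ℕ => regularProb d n (Q n)) (atTop ⊓ 𝓟 {n : ℕ | Even (d * n)}) (𝓝 1)

/-! A flipped node has at least `H` neighbours in its old group and `H` in its new one. Among `d`
neighbours these overlap in at least `2 * H - d ≥ 3`, and the overlap consists of flipped nodes
(`two_mul_le_add_ncard_flipped`). So two close assortative partitions yield a small non-empty set
`S` of minimum internal degree 3, spanning at least `3 * |S| / 2` edges.

Random regular graphs rarely contain such sets. Switchings show that `m` prescribed edges all occur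
with probability at most `(2 * d / n) ^ m` (`card_regularGraphsContaining_le`). For sets of size `s`
the union bound is then of order `(C * d ^ 3 * s / n) ^ (s / 2)`, whose sum over `1 ≤ s ≤ ε * n` is
`O(n ^ (-1/2))` (`card_denseRegularGraphs_le`). Degree 2 would not do: about `n ^ s` choices of `S`
would meet a probability of order `n ^ (-s)`. -/

namespace NodePartition

variable {V : Type*}

/-! ### Flipped nodes and the edges they span -/

theorem flipped_nonempty {P P' : NodePartition V} (h : P' ≠ P) : (flipped P P').Nonempty := by
  by_contra hne
  rw [Set.not_nonempty_iff_eq_empty] at hne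
  have hmem (v : V) : v ∈ flipped P P' → False := by simp [hne]
  have hP (v : V) : v ∈ P.neg ∨ v ∈ P.pos := by
    have : v ∈ P.neg ∪ P.pos := P.union_eq ▸ Set.mem_univ v
    exact this
  have hP' (v : V) : v ∈ P'.neg ∨ v ∈ P'.pos := by
    have : v ∈ P'.neg ∪ P'.pos := P'.union_eq ▸ Set.mem_univ v
    exact this
  have hd (v : V) : v ∈ P.neg → v ∈ P.pos → False := fun a b => P.disjoint.le_bot ⟨a, b⟩
  have hd' (v : V) : v ∈ P'.neg → v ∈ P'.pos → False := fun a b => P'.disjoint.le_bot ⟨a, b⟩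
  simp only [flipped, Set.mem_union, Set.mem_inter_iff] at hmem
  apply h
  ext v
  · grind
  · grind

/-- A node that is flipped between two `H`-assortative partitions has at least `2 H - d` of its
neighbours among the flipped nodes. -/
theorem two_mul_le_add_ncard_flipped [Finite V] {G : SimpleGraph V} {d H : ℕ}
    (hG : ∀ v, (G.neighborSet v).ncard = d) {P P' : NodePartition V}
    (hP : P.IsAssortative G H) (hP' : P'.IsAssortative G H) {v : V} (hv : v ∈ flipped P P') :
    2 * H ≤ d + (G.neighborSet v ∩ flipped P P').ncard := by
  have key (A B : Set V) (hA : H ≤ (G.neighborSet v ∩ A).ncard)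
      (hB : H ≤ (G.neighborSet v ∩ B).ncard) (hAB : A ∩ B ⊆ flipped P P') :
      2 * H ≤ d + (G.neighborSet v ∩ flipped P P').ncard := by
    have h1 := Set.ncard_union_add_ncard_inter (G.neighborSet v ∩ A) (G.neighborSet v ∩ B)
    have h2 : ((G.neighborSet v ∩ A) ∪ (G.neighborSet v ∩ B)).ncard ≤ d := by
      rw [← hG v]
      exact Set.ncard_le_ncard (by grind)
    have h3 : ((G.neighborSet v ∩ A) ∩ (G.neighborSet v ∩ B)).ncard ≤
        (G.neighborSet v ∩ flipped P P').ncard :=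
      Set.ncard_le_ncard (by grind)
    omega
  rcases hv with ⟨h, h'⟩ | ⟨h, h'⟩
  · exact key _ _ (hP.2 v h) (hP'.1 v h') fun w hw => Or.inl hw
  · exact key _ _ (hP.1 v h) (hP'.2 v h') fun w hw => Or.inr hw

end NodePartition

theorem mem_regularGraphs_iff_ncard {d n : ℕ} {G : SimpleGraph (Fin n)} :
    G ∈ regularGraphs d n ↔ ∀ v, (G.neighborSet v).ncard = d := by
  classical
  simp only [regularGraphs, Set.mem_ofPred_eq, SimpleGraph.IsRegularOfDegree]
  refine forall_congr' fun v => ?_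
  rw [Set.ncard_eq_toFinset_card', ← SimpleGraph.card_neighborFinset_eq_degree]
  simp only [SimpleGraph.neighborFinset]

/-- At most two ordered pairs give the same unordered pair. -/
theorem card_le_two_mul_card_of_forall_sym2_mem {V : Type*} [DecidableEq V]
    {T : Finset (V × V)} {F : Finset (Sym2 V)} (h : ∀ p ∈ T, s(p.1, p.2) ∈ F) :
    T.card ≤ 2 * F.card := by
  refine Finset.card_le_mul_card_image_of_maps_to (f := fun p : V × V => s(p.1, p.2)) h 2 ?_
  intro e _
  induction e with
  | _ a b =>
    refine (Finset.card_le_card (t := {(a, b), (b, a)}) ?_).trans Finset.card_le_two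
    rintro ⟨x, y⟩ hp
    simpa using (Finset.mem_filter.1 hp).2

/-- A set of `s` nodes, each having at least three neighbours in the set, spans at least `3 s / 2`
edges. -/
theorem exists_finset_edges_of_three_le {V : Type*} [Fintype V] [DecidableEq V]
    {G : SimpleGraph V} {S : Finset V} (h : ∀ v ∈ S, 3 ≤ (G.neighborSet v ∩ S).ncard) :
    ∃ F ⊆ S.sym2, F.card = (3 * S.card + 1) / 2 ∧ (F : Set (Sym2 V)) ⊆ G.edgeSet := by
  classical
  let T : Finset (V × V) := S.sigma (fun v => S.filter (G.Adj v)) |>.map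
    (Equiv.sigmaEquivProd V V).toEmbedding
  have hT (p : V × V) : p ∈ T ↔ p.1 ∈ S ∧ p.2 ∈ S ∧ G.Adj p.1 p.2 := by
    simp [T]
  have hcard : 3 * S.card ≤ T.card := by
    rw [Finset.card_map, Finset.card_sigma, mul_comm]
    refine Finset.card_nsmul_le_sum _ _ _ fun v hv => (h v hv).trans_eq ?_
    rw [← Set.ncard_coe_finset]
    congr 1
    ext w
    simp [and_comm]
  let E : Finset (Sym2 V) := T.image fun p => s(p.1, p.2)
  have hE : T.card ≤ 2 * E.card :=
    card_le_two_mul_card_of_forall_sym2_mem fun p hp => Finset.mem_image_of_mem _ hp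
  -- `(3 * s + 1) / 2` is `⌈3 * s / 2⌉`; fixing the size exactly makes the later probability bound
  -- depend on `s` alone.
  obtain ⟨F, hFE, hF⟩ := Finset.exists_subset_card_eq (s := E) (n := (3 * S.card + 1) / 2)
    (by omega)
  refine ⟨F, fun e he => ?_, hF, fun e he => ?_⟩
  · obtain ⟨p, hp, rfl⟩ := Finset.mem_image.1 (hFE he)
    have := (hT p).1 hp
    simp [this.1, this.2.1]
  · obtain ⟨p, hp, rfl⟩ := Finset.mem_image.1 (hFE he)
    exact ((hT p).1 hp).2.2

/-! ### Edge switchings -/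

/-- The graph obtained from `G` by replacing the edges `uv` and `xy` by `ux` and `vy`. -/
def SimpleGraph.switch {V : Type*} (G : SimpleGraph V) (u v x y : V) : SimpleGraph V :=
  SimpleGraph.fromEdgeSet ((G.edgeSet \ {s(u, v), s(x, y)}) ∪ {s(u, x), s(v, y)})

namespace SimpleGraph

variable {V : Type*} {G : SimpleGraph V} {u v x y : V}

theorem edgeSet_switch (hux : u ≠ x) (hvy : v ≠ y) :
    (G.switch u v x y).edgeSet = (G.edgeSet \ {s(u, v), s(x, y)}) ∪ {s(u, x), s(v, y)} := by
  rw [switch, edgeSet_fromEdgeSet, sdiff_eq_left, Set.disjoint_left]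
  rintro e (⟨he, -⟩ | rfl | rfl) hd
  · exact G.not_isDiag_of_mem_edgeSet he hd
  · exact hux (by simpa using hd)
  · exact hvy (by simpa using hd)

/-- A switching is undone by the reverse one, so `G` can be recovered from the switched graph and
the four nodes. This gives injectivity in the double count. -/
theorem edgeSet_eq_of_switch (huv : G.Adj u v) (hxy : G.Adj x y) (hux : u ≠ x) (hvy : v ≠ y)
    (hux' : ¬ G.Adj u x) (hvy' : ¬ G.Adj v y) :
    G.edgeSet = ((G.switch u v x y).edgeSet \ {s(u, x), s(v, y)}) ∪ {s(u, v), s(x, y)} := by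
  rw [edgeSet_switch hux hvy]
  have h1 : s(u, v) ∈ G.edgeSet := huv
  have h2 : s(x, y) ∈ G.edgeSet := hxy
  have h3 : s(u, x) ∉ G.edgeSet := hux'
  have h4 : s(v, y) ∉ G.edgeSet := hvy'
  ext e
  simp only [Set.mem_union, Set.mem_sdiff, Set.mem_insert_iff, Set.mem_singleton_iff]
  grind

/-- Each of the four nodes trades one neighbour for another; the two non-edges force the four nodes
to be distinct. -/
theorem ncard_neighborSet_switch [Finite V] (huv : G.Adj u v) (hxy : G.Adj x y) (hux : u ≠ x)
    (hvy : v ≠ y) (hux' : ¬ G.Adj u x) (hvy' : ¬ G.Adj v y) (w : V) :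
    ((G.switch u v x y).neighborSet w).ncard = (G.neighborSet w).ncard := by
  have huv' := huv.ne
  have hxy' := hxy.ne
  have hvx : v ≠ x := fun h => hux' (h ▸ huv)
  have huy : u ≠ y := fun h => hvy' (h ▸ huv.symm)
  have hadj (a b : V) : (G.switch u v x y).Adj a b ↔
      (G.Adj a b ∧ s(a, b) ≠ s(u, v) ∧ s(a, b) ≠ s(x, y)) ∨ s(a, b) = s(u, x) ∨
        s(a, b) = s(v, y) := by
    rw [← mem_edgeSet, edgeSet_switch hux hvy]
    simp only [Set.mem_union, Set.mem_sdiff, Set.mem_insert_iff, Set.mem_singleton_iff,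
      mem_edgeSet, not_or]
  have key (a b c : V) (hab : G.Adj a b) (hac : ¬ G.Adj a c)
      (h : ∀ z, (G.switch u v x y).Adj a z ↔ z = c ∨ (G.Adj a z ∧ z ≠ b)) :
      ((G.switch u v x y).neighborSet a).ncard = (G.neighborSet a).ncard := by
    have : (G.switch u v x y).neighborSet a = insert c (G.neighborSet a \ {b}) := by
      ext z
      simp [h]
    rw [this, Set.ncard_exchange (by simpa using hac) (by simpa using hab)]
  have hnux : ¬ G.Adj x u := fun h => hux' h.symm
  have hnvy : ¬ G.Adj y v := fun h => hvy' h.symm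
  by_cases h1 : w = u
  · subst h1
    exact key w v x huv hux' fun z => by rw [hadj]; simp only [Sym2.eq_iff, ne_eq]; grind
  by_cases h2 : w = v
  · subst h2
    exact key w u y huv.symm hvy' fun z => by rw [hadj]; simp only [Sym2.eq_iff, ne_eq]; grind
  by_cases h3 : w = x
  · subst h3
    exact key w y u hxy hnux fun z => by rw [hadj]; simp only [Sym2.eq_iff, ne_eq]; grind
  by_cases h4 : w = y
  · subst h4
    exact key w x v hxy.symm hnvy fun z => by rw [hadj]; simp only [Sym2.eq_iff, ne_eq]; grind
  congr 1
  ext z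
  rw [mem_neighborSet, mem_neighborSet, hadj]
  simp only [Sym2.eq_iff, ne_eq]
  grind

end SimpleGraph

/-! ### Regular graphs with prescribed edges -/

open scoped Classical in
/-- The `d`-regular graphs on `Fin n` having all elements of `F` as edges. -/
noncomputable def regularGraphsContaining (d n : ℕ) (F : Finset (Sym2 (Fin n))) :
    Finset (SimpleGraph (Fin n)) :=
  Finset.univ.filter fun G => G ∈ regularGraphs d n ∧ (F : Set (Sym2 (Fin n))) ⊆ G.edgeSet

open scoped Classical in
/-- The ordered pairs `(x, y)` for which `uv`, `xy` may be switched to `ux`, `vy` without loss of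
an edge from `F`. -/
noncomputable def switchPairs {n : ℕ} (F : Finset (Sym2 (Fin n))) (u v : Fin n)
    (G : SimpleGraph (Fin n)) : Finset (Fin n × Fin n) :=
  Finset.univ.filter fun p => G.Adj p.1 p.2 ∧ s(p.1, p.2) ∉ F ∧ u ≠ p.1 ∧ v ≠ p.2 ∧
    ¬ G.Adj u p.1 ∧ ¬ G.Adj v p.2

theorem mem_regularGraphsContaining {d n : ℕ} {F : Finset (Sym2 (Fin n))}
    {G : SimpleGraph (Fin n)} : G ∈ regularGraphsContaining d n F ↔
      (∀ v, (G.neighborSet v).ncard = d) ∧ (F : Set (Sym2 (Fin n))) ⊆ G.edgeSet := by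
  simp [regularGraphsContaining, mem_regularGraphs_iff_ncard]

open scoped Classical in
theorem card_filter_adj_eq {d n : ℕ} {G : SimpleGraph (Fin n)}
    (hG : ∀ v, (G.neighborSet v).ncard = d) (v : Fin n) :
    (Finset.univ.filter (G.Adj v)).card = d := by
  rw [← hG v, ← Set.ncard_coe_finset]
  congr 1
  ext w
  simp

/-- Of the `d * n` ordered adjacent pairs, at most `2 * |F|` come from `F`, and at most `d * (d +
1)` each have first entry in the closed neighbourhood of `u` or second entry in that of `v`. -/
theorem le_card_switchPairs {d n : ℕ} {F : Finset (Sym2 (Fin n))} {u v : Fin n}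
    {G : SimpleGraph (Fin n)} (hG : ∀ v, (G.neighborSet v).ncard = d) :
    d * n ≤ (switchPairs F u v G).card + 2 * F.card + 2 * (d * (d + 1)) := by
  classical
  let N : Fin n → Finset (Fin n) := fun w => Finset.univ.filter (G.Adj w)
  have hN (w : Fin n) : (N w).card = d := card_filter_adj_eq hG w
  have hN' (w : Fin n) : (insert w (N w)).card ≤ d + 1 :=
    (Finset.card_insert_le _ _).trans (by rw [hN])
  -- the ordered pairs of adjacent nodes whose first entry lies in `S`
  let D : Finset (Fin n) → Finset (Fin n × Fin n) := fun S =>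
    (S.sigma N).map (Equiv.sigmaEquivProd _ _).toEmbedding
  have hD (S : Finset (Fin n)) : (D S).card = S.card * d := by
    simp [D, Finset.card_sigma, hN]
  have memD (S : Finset (Fin n)) (p : Fin n × Fin n) :
      p ∈ D S ↔ p.1 ∈ S ∧ G.Adj p.1 p.2 := by
    simp only [D, Finset.mem_map, Finset.mem_sigma, N, Finset.mem_filter, Finset.mem_univ,
      true_and]
    constructor
    · rintro ⟨a, h1, rfl⟩
      exact h1
    · intro h1
      exact ⟨⟨p.1, p.2⟩, h1, rfl⟩
  let T : Finset (Fin n × Fin n) := (D Finset.univ).filter fun p => s(p.1, p.2) ∈ F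
  have hT : T.card ≤ 2 * F.card :=
    card_le_two_mul_card_of_forall_sym2_mem fun p hp => (Finset.mem_filter.1 hp).2
  let U := D (insert u (N u))
  let W := (D (insert v (N v))).map (Equiv.prodComm _ _).toEmbedding
  have hU : U.card ≤ (d + 1) * d := by
    rw [hD]; gcongr; exact hN' u
  have hW : W.card ≤ (d + 1) * d := by
    rw [Finset.card_map, hD]; gcongr; exact hN' v
  have hsub : D Finset.univ ⊆ (switchPairs F u v G ∪ T) ∪ (U ∪ W) := by
    rintro ⟨x, y⟩ hp
    have hxy : G.Adj x y := ((memD _ _).1 hp).2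
    by_cases h1 : (x, y) ∈ T
    · simp [h1]
    by_cases h2 : (x, y) ∈ U
    · simp [h2]
    by_cases h3 : (x, y) ∈ W
    · simp [h3]
    have h1' : s(x, y) ∉ F := fun h => h1 (Finset.mem_filter.2 ⟨hp, h⟩)
    have h2' : ¬ (x ∈ insert u (N u)) := fun h => h2 ((memD _ _).2 ⟨h, hxy⟩)
    have h3' : ¬ (y ∈ insert v (N v)) := fun h => h3 <|
      Finset.mem_map.2 ⟨(y, x), (memD _ _).2 ⟨h, hxy.symm⟩, rfl⟩
    simp only [N, Finset.mem_insert, Finset.mem_filter, Finset.mem_univ, true_and, not_or]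
      at h2' h3'
    refine Finset.mem_union_left _ (Finset.mem_union_left _ ?_)
    simp [switchPairs, hxy, h1', h2'.2, h3'.2, Ne.symm h2'.1, Ne.symm h3'.1]
  have h := (Finset.card_le_card hsub).trans (Finset.card_union_le _ _)
  have h4 := Finset.card_union_le (switchPairs F u v G) T
  have h5 := Finset.card_union_le U W
  rw [hD, Finset.card_univ, Fintype.card_fin] at h
  nlinarith

/-- The switching inequality: requiring one more edge costs a factor of order `d / n`. -/
theorem card_regularGraphsContaining_insert_mul_le {d n c : ℕ} {F : Finset (Sym2 (Fin n))}
    {e : Sym2 (Fin n)} (he : e ∉ F) (hc : c + 2 * F.card + 2 * (d * (d + 1)) ≤ d * n) :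
    (regularGraphsContaining d n (insert e F)).card * c ≤
      (regularGraphsContaining d n F).card * (d * d) := by
  classical
  induction e with
  | _ u v =>
    -- Double counting: `X` holds graphs with an admissible switching. After the switching, `x` is a
    -- neighbour of `u` and `y` one of `v`, so each resulting graph is hit at most `d * d` times.
    let X := (regularGraphsContaining d n (insert s(u, v) F)).sigma (switchPairs F u v)
    let Y := (regularGraphsContaining d n F).sigma fun G =>
      Finset.univ.filter (G.Adj u) ×ˢ Finset.univ.filter (G.Adj v)
    have hX : (regularGraphsContaining d n (insert s(u, v) F)).card * c ≤ X.card := by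
      rw [Finset.card_sigma]
      refine Finset.card_nsmul_le_sum _ _ _ fun G hG => ?_
      have := le_card_switchPairs (F := F) (u := u) (v := v)
        (mem_regularGraphsContaining.1 hG).1
      omega
    have hY : Y.card = (regularGraphsContaining d n F).card * (d * d) := by
      rw [Finset.card_sigma]
      refine Finset.sum_const_nat fun G hG => ?_
      have hG' := (mem_regularGraphsContaining.1 hG).1
      rw [Finset.card_product, card_filter_adj_eq hG', card_filter_adj_eq hG']
    have memX {t : Σ _ : SimpleGraph (Fin n), Fin n × Fin n} (ht : t ∈ X) :
        (∀ w, (t.1.neighborSet w).ncard = d) ∧ t.1.Adj u v ∧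
          (F : Set (Sym2 (Fin n))) ⊆ t.1.edgeSet ∧ t.1.Adj t.2.1 t.2.2 ∧ s(t.2.1, t.2.2) ∉ F ∧
          u ≠ t.2.1 ∧ v ≠ t.2.2 ∧ ¬ t.1.Adj u t.2.1 ∧ ¬ t.1.Adj v t.2.2 := by
      obtain ⟨h1, h2⟩ := Finset.mem_sigma.1 ht
      rw [mem_regularGraphsContaining, Finset.coe_insert, Set.insert_subset_iff] at h1
      exact ⟨h1.1, h1.2.1, h1.2.2, (Finset.mem_filter.1 h2).2⟩
    rw [← hY]
    refine hX.trans (Finset.card_le_card_of_injOn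
      (fun t => ⟨t.1.switch u v t.2.1 t.2.2, t.2⟩) ?_ ?_)
    · rintro ⟨G, x, y⟩ ht
      obtain ⟨hreg, huv, hF, hxy, hxyF, hux, hvy, hux', hvy'⟩ := memX ht
      simp only at *
      refine Finset.mem_coe.2 (Finset.mem_sigma.2
        ⟨mem_regularGraphsContaining.2 ⟨fun w => ?_, ?_⟩, ?_⟩)
      · rw [SimpleGraph.ncard_neighborSet_switch huv hxy hux hvy hux' hvy', hreg]
      · simp only
        rw [SimpleGraph.edgeSet_switch hux hvy]
        intro f hf
        refine Or.inl ⟨hF hf, ?_⟩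
        rintro (rfl | rfl)
        · exact he hf
        · exact hxyF hf
      · simp only [Finset.mem_product, Finset.mem_filter, Finset.mem_univ, true_and]
        simp only [← SimpleGraph.mem_edgeSet, SimpleGraph.edgeSet_switch hux hvy]
        simp
    · rintro ⟨G, x, y⟩ ht ⟨G', x', y'⟩ ht' heq
      obtain ⟨-, huv, -, hxy, -, hux, hvy, hux', hvy'⟩ := memX ht
      obtain ⟨-, huv₂, -, hxy₂, -, hux₂, hvy₂, hux₂', hvy₂'⟩ := memX ht'
      simp only [Sigma.mk.injEq, heq_eq_eq, Prod.mk.injEq] at heq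
      obtain ⟨hG, rfl, rfl⟩ := heq
      have : G = G' := by
        rw [← SimpleGraph.edgeSet_inj, SimpleGraph.edgeSet_eq_of_switch huv hxy hux hvy hux' hvy',
          hG, ← SimpleGraph.edgeSet_eq_of_switch huv₂ hxy₂ hux₂ hvy₂ hux₂' hvy₂']
      rw [this]

theorem card_regularGraphsContaining_le {d n : ℕ} (hn : 8 * (d + 1) ≤ n)
    (F : Finset (Sym2 (Fin n))) (hF : 8 * F.card ≤ d * n) :
    ((regularGraphsContaining d n F).card : ℝ) ≤
      (2 * d / n) ^ F.card * (regularGraphs d n).ncard := by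
  classical
  induction F using Finset.induction_on with
  | empty =>
    rw [← Set.ncard_coe_finset]
    simp [regularGraphsContaining]
  | insert e F he ih =>
    rw [Finset.card_insert_of_notMem he] at hF ⊢
    have ih := ih (by omega)
    have hc : ((d * n - 2 * F.card - 2 * (d * (d + 1))) + 2 * F.card + 2 * (d * (d + 1))) ≤
        d * n := by
      have : d * (8 * (d + 1)) ≤ d * n := Nat.mul_le_mul_left d hn
      have h8 : d * (8 * (d + 1)) = 8 * (d * (d + 1)) := by ring
      omega
    have hsw := card_regularGraphsContaining_insert_mul_le he hc
    -- Each of the two losses is at most `d * n / 4`, so at least half of the pairs remain and the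
    -- factor per edge is `d * d / (d * n / 2) = 2 * d / n`.
    have hlow : d * n ≤ 2 * (d * n - 2 * F.card - 2 * (d * (d + 1))) := by
      have : d * (8 * (d + 1)) ≤ d * n := Nat.mul_le_mul_left d hn
      have h8 : d * (8 * (d + 1)) = 8 * (d * (d + 1)) := by ring
      omega
    set A := (regularGraphsContaining d n (insert e F)).card
    set B := (regularGraphsContaining d n F).card
    have hnat : A * (d * n) ≤ B * (d * d) * 2 :=
      calc A * (d * n) ≤ A * (2 * (d * n - 2 * F.card - 2 * (d * (d + 1)))) := by gcongr
        _ = A * (d * n - 2 * F.card - 2 * (d * (d + 1))) * 2 := by ring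
        _ ≤ _ := by gcongr
    have hd : 0 < d := by
      rcases Nat.eq_zero_or_pos d with rfl | h
      · simp at hF
      · exact h
    have hn0 : (0 : ℝ) < n := by exact_mod_cast (by omega : 0 < n)
    have hd0 : (0 : ℝ) < d := by exact_mod_cast hd
    have hreal : (A : ℝ) * (d * n) ≤ B * (d * d) * 2 := by exact_mod_cast hnat
    have h1 : (A : ℝ) ≤ (2 * d / n) * B := by
      rw [div_mul_eq_mul_div, le_div_iff₀ hn0]
      nlinarith
    calc (A : ℝ) ≤ (2 * d / n) * B := h1
      _ ≤ (2 * d / n) * ((2 * d / n) ^ F.card * (regularGraphs d n).ncard) := by gcongr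
      _ = _ := by ring

/-! ### Existence of regular graphs -/

theorem exists_symmetric_finset_zmod {d n : ℕ} [NeZero n] (hdn : d < n) (he : Even (d * n)) :
    ∃ s : Finset (ZMod n), s.card = d ∧ 0 ∉ s ∧ ∀ x ∈ s, -x ∈ s := by
  classical
  set r := d / 2 with hr
  have hodd : d % 2 = 1 → n % 2 = 0 := by
    intro h
    rcases Nat.even_mul.1 he with h' | h'
    · rw [Nat.even_iff] at h'; omega
    · rwa [Nat.even_iff] at h'
  -- The residues `±1, …, ±r`, and for odd `d` also the self-inverse `n / 2`, as `n` is then even.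
  let T : Finset ℕ := (Finset.Icc 1 r ∪ Finset.Icc (n - r) (n - 1)) ∪
    (if d % 2 = 1 then {n / 2} else ∅)
  have memT (t : ℕ) : t ∈ T ↔ (1 ≤ t ∧ t ≤ r) ∨ (n - r ≤ t ∧ t ≤ n - 1) ∨
      (d % 2 = 1 ∧ t = n / 2) := by
    by_cases h : d % 2 = 1 <;> simp [T, h, or_assoc, or_comm]
  have hT : T.card = d := by
    rw [Finset.card_union_of_disjoint, Finset.card_union_of_disjoint]
    · simp only [Nat.card_Icc]
      split_ifs <;> simp <;> omega
    · rw [Finset.disjoint_left]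
      intro a ha hb
      rw [Finset.mem_Icc] at ha hb
      omega
    · rw [Finset.disjoint_left]
      intro a ha hb
      rw [Finset.mem_union, Finset.mem_Icc, Finset.mem_Icc] at ha
      split_ifs at hb with h
      · have := hodd h
        rw [Finset.mem_singleton] at hb
        omega
      · simp at hb
  have hlt : ∀ t ∈ T, 0 < t ∧ t < n := by
    intro t ht
    rw [memT] at ht
    have := hodd
    omega
  refine ⟨T.image (Nat.cast : ℕ → ZMod n), ?_, ?_, ?_⟩
  · rw [Finset.card_image_of_injOn, hT]
    intro a ha b hb hab
    have := congrArg ZMod.val hab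
    simpa [ZMod.val_natCast_of_lt (hlt a ha).2, ZMod.val_natCast_of_lt (hlt b hb).2] using this
  · intro h
    obtain ⟨t, ht, h0⟩ := Finset.mem_image.1 h
    have := congrArg ZMod.val h0
    rw [ZMod.val_natCast_of_lt (hlt t ht).2, ZMod.val_zero] at this
    have := (hlt t ht).1
    omega
  · intro x hx
    obtain ⟨t, ht, rfl⟩ := Finset.mem_image.1 hx
    have h := hlt t ht
    refine Finset.mem_image.2 ⟨n - t, ?_, ?_⟩
    · rw [memT] at ht ⊢
      have := hodd
      omega
    · rw [Nat.cast_sub h.2.le]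
      simp

/-- A circulant graph serves, `ZMod (N + 1)` being `Fin (N + 1)` by definition. Without it the
probability could be `0 / 0`. -/
theorem regularGraphs_nonempty {d n : ℕ} (hdn : d < n) (he : Even (d * n)) :
    (regularGraphs d n).Nonempty := by
  obtain ⟨N, rfl⟩ : ∃ N, n = N + 1 := ⟨n - 1, by omega⟩
  obtain ⟨s, hs, h0, hneg⟩ := exists_symmetric_finset_zmod hdn he
  let G : SimpleGraph (ZMod (N + 1)) := SimpleGraph.circulantGraph (s : Set (ZMod (N + 1)))
  have hG (v : ZMod (N + 1)) : (G.neighborSet v).ncard = d := by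
    have : G.neighborSet v = (fun x => x + v) '' (s : Set (ZMod (N + 1))) := by
      ext w
      simp only [G, SimpleGraph.mem_neighborSet, SimpleGraph.circulantGraph_adj, Set.mem_image,
        Finset.mem_coe]
      constructor
      · rintro ⟨-, h | h⟩
        · exact ⟨w - v, by simpa using hneg _ h, by ring⟩
        · exact ⟨w - v, h, by ring⟩
      · rintro ⟨x, hx, rfl⟩
        refine ⟨fun h => h0 ?_, Or.inr (by simpa using hx)⟩
        have : x = 0 := by simpa using h
        exact this ▸ hx
    rw [this, Set.ncard_image_of_injective _ (add_left_injective v), Set.ncard_coe_finset, hs]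
  exact ⟨G, mem_regularGraphs_iff_ncard.2 hG⟩

/-! ### The union bound -/

theorem Nat.cast_choose_le_three_mul_div_pow (N m : ℕ) (hm : 0 < m) :
    (N.choose m : ℝ) ≤ (3 * N / m) ^ m := by
  have hm0 : (0 : ℝ) < m := by exact_mod_cast hm
  have h1 : (N.choose m : ℝ) ≤ (N : ℝ) ^ m / (m.factorial : ℝ) := Nat.choose_le_pow_div m N
  have h2 : (m : ℝ) ^ m / (m.factorial : ℝ) ≤ 3 ^ m := by
    refine (Real.pow_div_factorial_le_exp (m : ℝ) hm0.le m).trans ?_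
    rw [← Real.exp_one_pow]
    exact pow_le_pow_left₀ (Real.exp_pos 1).le Real.exp_one_lt_three.le m
  calc (N.choose m : ℝ) ≤ (N : ℝ) ^ m / (m.factorial : ℝ) := h1
    _ = (N : ℝ) ^ m / (m : ℝ) ^ m * ((m : ℝ) ^ m / (m.factorial : ℝ)) := by
        field_simp
    _ ≤ (N : ℝ) ^ m / (m : ℝ) ^ m * 3 ^ m := by gcongr
    _ = (3 * N / m) ^ m := by rw [div_pow, mul_pow]; ring

/-- The union bound over the sets of `s` nodes and the sets of at least `3 s / 2` pairs of nodes
inside them is geometrically small in `s`. -/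
theorem choose_mul_choose_mul_pow_le {d n s : ℕ} (hd : 0 < d) (hs : 0 < s)
    (hsn : 9216 * d ^ 3 * s ≤ n) :
    (n.choose s : ℝ) * (((s + 1).choose 2).choose ((3 * s + 1) / 2) : ℝ) *
        (2 * d / n) ^ ((3 * s + 1) / 2) ≤
      √(576 * d ^ 3 / n) * (1 / 2) ^ (s - 1) := by
  set m := (3 * s + 1) / 2 with hm
  have hm1 : 3 * s ≤ 2 * m := by omega
  have hd1 : d ≤ d ^ 3 := Nat.le_self_pow (by norm_num) d
  have hn : 0 < n := lt_of_lt_of_le (by positivity) hsn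
  have hs0 : (0 : ℝ) < s := by exact_mod_cast hs
  have hd0 : (0 : ℝ) < d := by exact_mod_cast hd
  have hn0 : (0 : ℝ) < n := by exact_mod_cast hn
  have hm0 : (0 : ℝ) < m := by exact_mod_cast (by omega : 0 < m)
  have hm1' : (3 * s : ℝ) ≤ 2 * m := by exact_mod_cast hm1
  have hA : (n.choose s : ℝ) ≤ (3 * n / s) ^ s := Nat.cast_choose_le_three_mul_div_pow n s hs
  have hsq : (s + 1).choose 2 ≤ s ^ 2 := by
    rw [Nat.choose_two_right]
    refine Nat.div_le_of_le_mul ?_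
    rw [Nat.add_sub_cancel]
    nlinarith
  have hB : (((s + 1).choose 2).choose m : ℝ) ≤ (2 * s) ^ m := by
    calc (((s + 1).choose 2).choose m : ℝ) ≤ ((s ^ 2).choose m : ℝ) := by
          exact_mod_cast Nat.choose_le_choose m hsq
      _ ≤ (3 * ((s ^ 2 : ℕ) : ℝ) / m) ^ m :=
          Nat.cast_choose_le_three_mul_div_pow _ m (by omega)
      _ ≤ (2 * s) ^ m := by
          gcongr
          rw [div_le_iff₀ hm0]
          push_cast
          nlinarith
  have hq : (4 * d * s / n : ℝ) ≤ 1 := by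
    rw [div_le_one hn0]
    have : 4 * d * s ≤ n := by nlinarith
    exact_mod_cast this
  have hK : (576 * d ^ 3 * s / n : ℝ) ≤ 1 / 16 := by
    rw [div_le_iff₀ hn0]
    have : (9216 * d ^ 3 * s : ℝ) ≤ n := by exact_mod_cast hsn
    linarith
  have hs4 : (s : ℝ) ≤ 4 ^ (s - 1) := by
    have : s - 1 < 4 ^ (s - 1) := Nat.lt_pow_self (by norm_num)
    exact_mod_cast (by omega : s ≤ 4 ^ (s - 1))
  have hle : (n.choose s : ℝ) * (((s + 1).choose 2).choose m : ℝ) * (2 * d / n) ^ m ≤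
      (3 * n / s) ^ s * (4 * d * s / n) ^ m := by
    calc _ ≤ (3 * n / s : ℝ) ^ s * (2 * s) ^ m * (2 * d / n) ^ m := by gcongr
      _ = (3 * n / s) ^ s * ((2 * s) * (2 * d / n)) ^ m := by rw [mul_pow (2 * s : ℝ)]; ring
      _ = _ := by congr 2; ring
  -- Squaring avoids half-integer exponents: `2 * m ≥ 3 * s`, and `(3 * n / s) ^ 2 * (4 * d * s / n)
  -- ^ 3 = 576 * d ^ 3 * s / n`, at most `1 / 16` since `9216 = 16 * 576`. One such factor is kept
  -- for decay in `n`; its `s` is absorbed by `4 ^ (s - 1)`.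
  refine hle.trans (le_of_sq_le_sq ?_ (by positivity))
  rw [mul_pow (√_), Real.sq_sqrt (by positivity)]
  calc ((3 * n / s : ℝ) ^ s * (4 * d * s / n) ^ m) ^ 2
      = (((3 * n / s) ^ 2) ^ s * (4 * d * s / n) ^ (2 * m) : ℝ) := by
        rw [mul_pow, ← pow_mul, ← pow_mul, ← pow_mul, mul_comm s 2, mul_comm m 2]
    _ ≤ (((3 * n / s) ^ 2) ^ s * (4 * d * s / n) ^ (3 * s) : ℝ) :=
        mul_le_mul_of_nonneg_left (pow_le_pow_of_le_one (by positivity) hq hm1) (by positivity)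
    _ = (576 * d ^ 3 * s / n : ℝ) ^ s := by
        rw [pow_mul _ 3, ← mul_pow]
        congr 1
        field_simp
        norm_num
    _ = (576 * d ^ 3 * s / n : ℝ) * (576 * d ^ 3 * s / n) ^ (s - 1) := by
        rw [mul_pow_sub_one hs.ne']
    _ ≤ (576 * d ^ 3 * s / n : ℝ) * (1 / 16) ^ (s - 1) := by gcongr
    _ = (576 * d ^ 3 / n : ℝ) * (1 / 16) ^ (s - 1) * s := by ring
    _ ≤ (576 * d ^ 3 / n : ℝ) * (1 / 16) ^ (s - 1) * 4 ^ (s - 1) := by gcongr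
    _ = (576 * d ^ 3 / n : ℝ) * ((1 / 2) ^ (s - 1)) ^ 2 := by
        rw [mul_assoc, ← mul_pow, ← pow_mul, mul_comm (s - 1), pow_mul]
        norm_num

open scoped Classical in
/-- The `d`-regular graphs on `Fin n` with a non-empty set of at most `L` nodes each of which has
at least three neighbours in the set. -/
noncomputable def denseRegularGraphs (d n L : ℕ) : Finset (SimpleGraph (Fin n)) :=
  Finset.univ.filter fun G => G ∈ regularGraphs d n ∧ ∃ S : Finset (Fin n), S.Nonempty ∧
    S.card ≤ L ∧ ∀ v ∈ S, 3 ≤ (G.neighborSet v ∩ S).ncard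

theorem card_denseRegularGraphs_le {d n L : ℕ} (hd : 0 < d) (hn : 8 * (d + 1) ≤ n)
    (hL : 9216 * d ^ 3 * L ≤ n) :
    ((denseRegularGraphs d n L).card : ℝ) ≤
      2 * √(576 * d ^ 3 / n) * (regularGraphs d n).ncard := by
  classical
  set R : ℝ := ((regularGraphs d n).ncard : ℝ)
  have hd1 : 1 ≤ d ^ 3 := Nat.one_le_pow _ _ hd
  have hsub : denseRegularGraphs d n L ⊆ (Finset.Icc 1 L).biUnion fun s =>
      (Finset.powersetCard s Finset.univ).biUnion fun S =>
        (Finset.powersetCard ((3 * s + 1) / 2) S.sym2).biUnion fun F =>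
          regularGraphsContaining d n F := by
    intro G hG
    obtain ⟨hreg, S, hS, hSL, hdeg⟩ := (Finset.mem_filter.1 hG).2
    obtain ⟨F, hFS, hF, hFG⟩ := exists_finset_edges_of_three_le hdeg
    simp only [Finset.mem_biUnion, Finset.mem_Icc, Finset.mem_powersetCard]
    exact ⟨S.card, ⟨hS.card_pos, hSL⟩, S, ⟨Finset.subset_univ _, rfl⟩, F, ⟨hFS, hF⟩,
      mem_regularGraphsContaining.2 ⟨mem_regularGraphs_iff_ncard.1 hreg, hFG⟩⟩
  have hterm (s : ℕ) (hs : s ∈ Finset.Icc 1 L) :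
      (((Finset.powersetCard s Finset.univ).biUnion fun S : Finset (Fin n) =>
        (Finset.powersetCard ((3 * s + 1) / 2) S.sym2).biUnion fun F =>
          regularGraphsContaining d n F).card : ℝ) ≤
        √(576 * d ^ 3 / n) * (1 / 2) ^ (s - 1) * R := by
    obtain ⟨hs1, hsL⟩ := Finset.mem_Icc.1 hs
    have hsn : 9216 * d ^ 3 * s ≤ n := (Nat.mul_le_mul_left _ hsL).trans hL
    have hF (S : Finset (Fin n)) (hS : S ∈ Finset.powersetCard s Finset.univ) :
        (((Finset.powersetCard ((3 * s + 1) / 2) S.sym2).biUnion fun F =>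
          regularGraphsContaining d n F).card : ℝ) ≤
          (((s + 1).choose 2).choose ((3 * s + 1) / 2) : ℝ) *
            ((2 * d / n) ^ ((3 * s + 1) / 2) * R) := by
      have hcard : S.card = s := (Finset.mem_powersetCard.1 hS).2
      calc _ ≤ ((∑ F ∈ Finset.powersetCard ((3 * s + 1) / 2) S.sym2,
              (regularGraphsContaining d n F).card : ℕ) : ℝ) := by
            exact_mod_cast Finset.card_biUnion_le
        _ ≤ ∑ F ∈ Finset.powersetCard ((3 * s + 1) / 2) S.sym2,
              (2 * d / n : ℝ) ^ ((3 * s + 1) / 2) * R := by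
            push_cast
            refine Finset.sum_le_sum fun F hF => ?_
            have hFc := (Finset.mem_powersetCard.1 hF).2
            rw [← hFc]
            refine card_regularGraphsContaining_le hn F ?_
            have : 8 * F.card ≤ 16 * s := by omega
            nlinarith
        _ = _ := by
            rw [Finset.sum_const, Finset.card_powersetCard, Finset.card_sym2, hcard, nsmul_eq_mul]
    calc _ ≤ ((∑ S ∈ Finset.powersetCard s (Finset.univ : Finset (Fin n)),
            ((Finset.powersetCard ((3 * s + 1) / 2) S.sym2).biUnion fun F =>
              regularGraphsContaining d n F).card : ℕ) : ℝ) := by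
          exact_mod_cast Finset.card_biUnion_le
      _ ≤ ∑ S ∈ Finset.powersetCard s (Finset.univ : Finset (Fin n)),
            (((s + 1).choose 2).choose ((3 * s + 1) / 2) : ℝ) *
              ((2 * d / n) ^ ((3 * s + 1) / 2) * R) := by
          push_cast
          exact Finset.sum_le_sum hF
      _ = ((n.choose s : ℝ) * (((s + 1).choose 2).choose ((3 * s + 1) / 2) : ℝ) *
            (2 * d / n) ^ ((3 * s + 1) / 2)) * R := by
          rw [Finset.sum_const, Finset.card_powersetCard, Finset.card_univ, Fintype.card_fin,
            nsmul_eq_mul]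
          ring
      _ ≤ _ :=
          mul_le_mul_of_nonneg_right (choose_mul_choose_mul_pow_le hd hs1 hsn) (Nat.cast_nonneg _)
  have hgeom : ∑ s ∈ Finset.Icc 1 L, (1 / 2 : ℝ) ^ (s - 1) ≤ 2 := by
    have : Finset.Icc 1 L = (Finset.range L).map (addRightEmbedding 1) := by
      rw [Finset.range_eq_Ico, Finset.map_add_right_Ico]
      rfl
    rw [this, Finset.sum_map]
    simpa using sum_geometric_two_le L
  calc ((denseRegularGraphs d n L).card : ℝ)
      ≤ ((∑ s ∈ Finset.Icc 1 L, ((Finset.powersetCard s Finset.univ).biUnion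
          fun S : Finset (Fin n) => (Finset.powersetCard ((3 * s + 1) / 2) S.sym2).biUnion fun F =>
            regularGraphsContaining d n F).card : ℕ) : ℝ) := by
        exact_mod_cast (Finset.card_le_card hsub).trans Finset.card_biUnion_le
    _ ≤ ∑ s ∈ Finset.Icc 1 L, √(576 * d ^ 3 / n) * (1 / 2) ^ (s - 1) * R := by
        push_cast
        exact Finset.sum_le_sum hterm
    _ = √(576 * d ^ 3 / n) * (∑ s ∈ Finset.Icc 1 L, (1 / 2 : ℝ) ^ (s - 1)) * R := by
        rw [Finset.mul_sum, Finset.sum_mul]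
    _ ≤ √(576 * d ^ 3 / n) * 2 * R := by gcongr
    _ = _ := by ring

/-! ### Conclusion -/

theorem three_add_le_two_mul_ceil_half_add {d k : ℕ} (hk_even : Even d → 2 ≤ k)
    (hk_odd : Odd d → 1 ≤ k) : d + 3 ≤ 2 * (⌈(d : ℝ) / 2⌉₊ + k) := by
  have h : d ≤ 2 * ⌈(d : ℝ) / 2⌉₊ := by
    have := Nat.le_ceil ((d : ℝ) / 2)
    exact_mod_cast (by linarith : (d : ℝ) ≤ 2 * (⌈(d : ℝ) / 2⌉₊ : ℝ))
  rcases Nat.even_or_odd d with hd | hd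
  · have := hk_even hd
    omega
  · have := hk_odd hd
    rw [Nat.odd_iff] at hd
    omega

theorem mem_denseRegularGraphs_of_not_isFrozen {d n H : ℕ} {ε : ℝ} {G : SimpleGraph (Fin n)}
    (hH : d + 3 ≤ 2 * H) (hG : G ∈ regularGraphs d n) {P : NodePartition (Fin n)}
    (hP : P.IsAssortative G H) (hfrozen : ¬ P.IsFrozen G H ε) :
    G ∈ denseRegularGraphs d n ⌊ε * n⌋₊ := by
  classical
  obtain ⟨P', hne, hP', hle⟩ := not_not.1 hfrozen
  rw [Nat.card_fin] at hle
  refine Finset.mem_filter.2 ⟨Finset.mem_univ _, hG, (P.flipped P').toFinset, ?_, ?_, ?_⟩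
  · simpa using NodePartition.flipped_nonempty hne
  · rw [← Set.ncard_eq_toFinset_card']
    exact Nat.le_floor hle
  · intro v hv
    have := NodePartition.two_mul_le_add_ncard_flipped (mem_regularGraphs_iff_ncard.1 hG) hP hP'
      (Set.mem_toFinset.1 hv)
    rw [Set.coe_toFinset]
    omega

theorem theorem1 (d k : ℕ) (hd : 3 ≤ d) (hk_even : Even d → 2 ≤ k) (hk_odd : Odd d → 1 ≤ k) :
    ∃ ε : ℝ, 0 < ε ∧
      WithHighProbability d (fun n G =>
        ∀ P : NodePartition (Fin n), P.IsAssortative G (⌈(d : ℝ) / 2⌉₊ + k) →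
          P.IsFrozen G (⌈(d : ℝ) / 2⌉₊ + k) ε) := by
  classical
  have hd0 : (0 : ℝ) < d := by exact_mod_cast (by omega : 0 < d)
  have hH := three_add_le_two_mul_ceil_half_add hk_even hk_odd
  generalize ⌈(d : ℝ) / 2⌉₊ + k = H at hH ⊢
  -- The largest `ε` for which `⌊ε * n⌋₊` always meets the size condition of
  -- `card_denseRegularGraphs_le`.
  set ε : ℝ := 1 / (9216 * d ^ 3) with hε
  refine ⟨ε, by positivity, ?_⟩
  have hlim : Tendsto (fun n : ℕ => 1 - 2 * √(576 * d ^ 3 / (n : ℝ)))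
      (atTop ⊓ 𝓟 {n : ℕ | Even (d * n)}) (𝓝 1) := by
    have h1 : Tendsto (fun n : ℕ => (576 * d ^ 3 : ℝ) / n) atTop (𝓝 0) :=
      tendsto_const_div_atTop_nhds_zero_nat _
    have h2 := ((h1.sqrt).const_mul 2).const_sub 1
    simp only [Real.sqrt_zero, mul_zero, sub_zero] at h2
    exact h2.mono_left inf_le_left
  refine tendsto_of_tendsto_of_tendsto_of_le_of_le' hlim tendsto_const_nhds ?_ ?_
  · rw [eventually_inf_principal]
    filter_upwards [eventually_ge_atTop (8 * (d + 1))] with n hn he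
    have hR : 0 < (regularGraphs d n).ncard :=
      (Set.ncard_pos (Set.toFinite _)).2 (regularGraphs_nonempty (by omega) he)
    have hR' : (0 : ℝ) < (regularGraphs d n).ncard := by exact_mod_cast hR
    have hL : 9216 * d ^ 3 * ⌊ε * n⌋₊ ≤ n := by
      have h := Nat.floor_le (a := ε * n) (by positivity)
      have : (9216 * d ^ 3 * ⌊ε * n⌋₊ : ℝ) ≤ n := by
        calc (9216 * d ^ 3 * ⌊ε * n⌋₊ : ℝ) ≤ 9216 * d ^ 3 * (ε * n) := by gcongr
          _ = n := by rw [hε]; field_simp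
      exact_mod_cast this
    have hbad := card_denseRegularGraphs_le (by omega) hn hL
    set good := {G | G ∈ regularGraphs d n ∧ ∀ P : NodePartition (Fin n),
      P.IsAssortative G H → P.IsFrozen G H ε} with hgood
    have hcover : regularGraphs d n ⊆ good ∪ denseRegularGraphs d n ⌊ε * n⌋₊ := by
      intro G hG
      by_cases h : ∀ P : NodePartition (Fin n), P.IsAssortative G H → P.IsFrozen G H ε
      · exact Or.inl ⟨hG, h⟩
      · push Not at h
        obtain ⟨P, hP, hf⟩ := h
        exact Or.inr (mem_denseRegularGraphs_of_not_isFrozen hH hG hP hf)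
    have hcard : (regularGraphs d n).ncard ≤
        good.ncard + (denseRegularGraphs d n ⌊ε * n⌋₊).card := by
      rw [← Set.ncard_coe_finset]
      exact (Set.ncard_le_ncard hcover (Set.toFinite _)).trans (Set.ncard_union_le _ _)
    have hcard' : ((regularGraphs d n).ncard : ℝ) ≤
        good.ncard + (denseRegularGraphs d n ⌊ε * n⌋₊).card := by exact_mod_cast hcard
    rw [regularProb, ← hgood, le_div_iff₀ hR']
    linarith
  -- This also covers an empty set of regular graphs, where the quotient is `0`.
  · refine Eventually.of_forall fun n => div_le_one_of_le₀ ?_ (by positivity)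
    exact_mod_cast Set.ncard_le_ncard (Set.inter_subset_left (s := regularGraphs d n))
      (Set.toFinite _)
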